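/- Let $A,B,J$ be finite-dimensional complex Hilbert spaces, with $J\neq 0$, and let $\mathcal N:\mathcal L(A\otimes J)\to\mathcal L(B)$ be a completely positive trace-preserving map (a quantum arbitrarily varying channel, QAVC, with sender $A$, receiver $B$ and jammer $J$). Write $\mathcal S(X)$ for the set of states (density operators) on $X$, and $X^\ell=X^{\otimes\ell}$. For $\sigma\in\mathcal S(J)$ let $\mathcal N_\sigma(\rho)=\mathcal N(\rho\otimes\sigma)$. A classical code of block length $\ell$ is a collection $\mathcal C=\{(\rho_m,D_m):m=1,\dots,M\}$ with states $\rho_m\in\mathcal S(A^{\ell})$ and operators $D_m\ge 0$ on $B^{\ell}$ such that $\sum_{m=1}^M D_m=\mathbb 1$. Its error probability with respect to a jammer state $\zeta\in\mathcal S(J^{\ell})$ is \[ P_{\mathrm{err}}(\mathcal C,\zeta)=\frac1M\sum_{m=1}^M\operatorname{tr}\bigl(\mathcal N^{\otimes\ell}(\rho_m\otimes\zeta)\,(\mathbb 1-D_m)\bigr), \] where $A^\ell\otimes J^\ell$ is identified with $(A\otimes J)^{\otimes\ell}$. For a permutation $\pi\in S_\ell$ and any Hilbert space $X$, let $U^\pi$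 be the unitary on $X^{\ell}$ with $U^\pi(|\alpha_1\rangle\cdots|\alpha_\ell\rangle)=|\alpha_{\pi^{-1}(1)}\rangle\cdots|\alpha_{\pi^{-1}(\ell)}\rangle$. Let $\varepsilon\in\mathbb R$ and let $\mathcal C=\{(\rho_m,D_m):m=1,\dots,M\}$ be a code of block length $\ell$ with error probability at most $\varepsilon$ for the compound channel $\{\mathcal N_\sigma\}_{\sigma\in\mathcal S(J)}$, i.e. for all $\sigma\in\mathcal S(J)$, \[ P_{\mathrm{err}}(\mathcal C,\sigma^{\otimes\ell})=\frac1M\sum_{m=1}^M\operatorname{tr}\bigl(\mathcal N_\sigma^{\otimes\ell}(\rho_m)\,(\mathbb 1-D_m)\bigr)\le\varepsilon . \] Consider the random code $(\mathcal C_\pi)_{\pi\in S_\ell}$ with $\pi$ uniformly distributed on $S_\ell$ and \[ \mathcal C_\pi=\{(U^\pi\rho_mU^{\pi\dagger},\,U^\pi D_mU^{\pi\dagger}):m=1,\dots,M\}. \] Then for every state $\zeta\in\mathcal S(J^{\ell})$ (possibly entangled across the $\ell$ systems), \[ \mathbb E_\pi P_{\mathrm{err}}(\mathcal C_\pi,\zeta)\le\varepsilon\,(\ell+1)^{|J|^2},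 \] where $|J|=\dim J$. -/

import Mathlib

open scoped Matrix Kronecker ComplexOrder

namespace QAVC

noncomputable section

/-- Operators on the finite dimensional Hilbert space with orthonormal basis labelled by `X`. -/
abbrev Op (X : Type*) := Matrix X X ℂ

/-- A basis of the `ℓ`-fold tensor power: tuples of basis labels. -/
abbrev Pow (X : Type*) (ℓ : ℕ) := Fin ℓ → X

/-- Quantum states (density operators). -/
structure State (X : Type*) [Fintype X] where
  op : Op X
  posSemidef : op.PosSemidef
  trace_eq_one : op.trace = 1

/-- `id_k ⊗ T`, applied to an operator on `ℂ^k ⊗ X`. -/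
def ampliation {X Y : Type*} (T : Op X →ₗ[ℂ] Op Y) (k : ℕ) (P : Op (Fin k × X)) :
    Op (Fin k × Y) :=
  Matrix.of fun p q => T (Matrix.of fun x x' => P (p.1, x) (q.1, x')) p.2 q.2

/-- Complete positivity: all `id_k ⊗ T` preserve positive semidefiniteness. -/
def IsCompletelyPositive {X Y : Type*} [Fintype X] [Fintype Y] (T : Op X →ₗ[ℂ] Op Y) : Prop :=
  ∀ (k : ℕ) (P : Op (Fin k × X)), P.PosSemidef → (ampliation T k P).PosSemidef

/-- Completely positive and trace preserving maps. -/
structure Channel (X Y : Type*) [Fintype X] [Fintype Y] where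
  map : Op X →ₗ[ℂ] Op Y
  completelyPositive : IsCompletelyPositive map
  tracePreserving : ∀ P, (map P).trace = P.trace

/-- The product operator `P 0 ⊗ ⋯ ⊗ P (ℓ - 1)`. -/
def tensorOp {X : Type*} {ℓ : ℕ} (P : Fin ℓ → Op X) : Op (Pow X ℓ) :=
  Matrix.of fun x x' => ∏ i, P i (x i) (x' i)

/-- The tensor power `T^{⊗ℓ}` of a linear map, given by its values
on matrix units and linearity; see `tensorPowMap_tensorOp`. -/
def tensorPowMap {X Y : Type*} [Fintype X] [DecidableEq X] (T : Op X →ₗ[ℂ] Op Y) (ℓ : ℕ) :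
    Op (Pow X ℓ) →ₗ[ℂ] Op (Pow Y ℓ) where
  toFun P := Matrix.of fun y y' =>
    ∑ x, ∑ x', P x x' * ∏ i, T (Matrix.single (x i) (x' i) 1) (y i) (y' i)
  map_add' P Q := by
    ext y y'
    simp [add_mul, Finset.sum_add_distrib]
  map_smul' c P := by
    ext y y'
    simp [Finset.mul_sum, mul_assoc]

theorem map_apply_eq_sum {X Y : Type*} [Fintype X] [DecidableEq X] (T : Op X →ₗ[ℂ] Op Y)
    (P : Op X) (y y' : Y) :
    T P y y' = ∑ x, ∑ x', P x x' * T (Matrix.single x x' 1) y y' := by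
  conv_lhs => rw [Matrix.matrix_eq_sum_single P]
  simp only [map_sum, Matrix.sum_apply]
  refine Finset.sum_congr rfl fun x _ => Finset.sum_congr rfl fun x' _ => ?_
  have : Matrix.single x x' (P x x') = P x x' • Matrix.single x x' (1 : ℂ) := by simp
  rw [this, map_smul]
  simp

theorem prod_sum_sum {X : Type*} [Fintype X] {ℓ : ℕ} (f : Fin ℓ → X → X → ℂ) :
    ∏ i, ∑ x, ∑ x', f i x x' = ∑ x : Pow X ℓ, ∑ x' : Pow X ℓ, ∏ i, f i (x i) (x' i) := by
  classical
  rw [Finset.prod_univ_sum, Fintype.piFinset_univ]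
  refine Finset.sum_congr rfl fun x _ => ?_
  rw [Finset.prod_univ_sum, Fintype.piFinset_univ]

/-- `T^{⊗ℓ} (P 0 ⊗ ⋯ ⊗ P (ℓ - 1)) = T (P 0) ⊗ ⋯ ⊗ T (P (ℓ - 1))`. -/
theorem tensorPowMap_tensorOp {X Y : Type*} [Fintype X] [DecidableEq X]
    (T : Op X →ₗ[ℂ] Op Y) {ℓ : ℕ} (P : Fin ℓ → Op X) :
    tensorPowMap T ℓ (tensorOp P) = tensorOp fun i => T (P i) := by
  ext y y'
  simp only [tensorPowMap, tensorOp, LinearMap.coe_mk, AddHom.coe_mk, Matrix.of_apply]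
  simp_rw [map_apply_eq_sum T (P _), ← Finset.prod_mul_distrib]
  rw [prod_sum_sum]

theorem tensorOp_mul {X : Type*} [Fintype X] {ℓ : ℕ} (P Q : Fin ℓ → Op X) :
    tensorOp P * tensorOp Q = tensorOp fun i => P i * Q i := by
  classical
  ext x x'
  simp only [tensorOp, Matrix.mul_apply, Matrix.of_apply, ← Finset.prod_mul_distrib]
  rw [Finset.prod_univ_sum, Fintype.piFinset_univ]

theorem tensorOp_conjTranspose {X : Type*} {ℓ : ℕ} (P : Fin ℓ → Op X) :
    (tensorOp P)ᴴ = tensorOp fun i => (P i)ᴴ := by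
  ext x x'
  simp [tensorOp, Matrix.conjTranspose_apply]

section

open scoped MatrixOrder

theorem exists_eq_conjTranspose_mul_self {X : Type*} [Fintype X] {P : Op X}
    (hP : P.PosSemidef) : ∃ R : Op X, P = Rᴴ * R := by
  classical
  exact CStarAlgebra.nonneg_iff_eq_star_mul_self.mp hP.nonneg

end

/-- The i.i.d. state `σ^{⊗ℓ}`. -/
def State.pow {X : Type*} [Fintype X] (σ : State X) (ℓ : ℕ) : State (Pow X ℓ) where
  op := tensorOp fun _ => σ.op
  posSemidef := by
    classical
    obtain ⟨R, hR⟩ := exists_eq_conjTranspose_mul_self σ.posSemidef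
    rw [hR, ← tensorOp_mul, ← tensorOp_conjTranspose]
    exact Matrix.posSemidef_conjTranspose_mul_self _
  trace_eq_one := by
    classical
    have h := Finset.prod_univ_sum (fun _ : Fin ℓ => (Finset.univ : Finset X))
      (fun _ x => σ.op x x)
    rw [Fintype.piFinset_univ] at h
    simp only [Matrix.trace, Matrix.diag_apply, tensorOp, Matrix.of_apply]
    rw [← h]
    have := σ.trace_eq_one
    simp only [Matrix.trace, Matrix.diag_apply] at this
    simp [this]

section

variable {A B J : Type*} [Fintype A] [Fintype B] [Fintype J]
  [DecidableEq A] [DecidableEq B] [DecidableEq J]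

/-- `𝒩^{⊗ℓ} (ρ ⊗ σ)` for operators `ρ` on `A^ℓ` and `σ` on `J^ℓ`, where `A^ℓ ⊗ J^ℓ` is
identified with `(A ⊗ J)^ℓ` in the usual way. -/
def blockOutput (N : Channel (A × J) B) {ℓ : ℕ} (ρ : Op (Pow A ℓ)) (σ : Op (Pow J ℓ)) :
    Op (Pow B ℓ) :=
  tensorPowMap N.map ℓ
    (Matrix.reindex (Equiv.arrowProdEquivProdArrow (Fin ℓ) (fun _ => A) (fun _ => J)).symm
      (Equiv.arrowProdEquivProdArrow (Fin ℓ) (fun _ => A) (fun _ => J)).symm (ρ ⊗ₖ σ))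

/-- The map `𝒩_σ : ρ ↦ 𝒩 (ρ ⊗ σ)` obtained by fixing the jammer's state. -/
def fixJammer (N : Channel (A × J) B) (σ : State J) : Op A →ₗ[ℂ] Op B where
  toFun ρ := N.map (ρ ⊗ₖ σ.op)
  map_add' ρ ρ' := by rw [Matrix.add_kronecker, map_add]
  map_smul' c ρ := by rw [Matrix.smul_kronecker, map_smul, RingHom.id_apply]

/-- A deterministic classical code of block length `ℓ` with `M` messages. -/
structure Code (A B : Type*) [Fintype A] [Fintype B] [DecidableEq B] (ℓ M : ℕ) where
  enc : Fin M → State (Pow A ℓ)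
  dec : Fin M → Op (Pow B ℓ)
  dec_posSemidef : ∀ m, (dec m).PosSemidef
  dec_sum : ∑ m, dec m = 1

/-- The average error probability of a code for the QAVC `N`
with respect to a jammer state on `J^ℓ`. -/
def errorProb (N : Channel (A × J) B) {ℓ M : ℕ} (C : Code A B ℓ M) (σ : State (Pow J ℓ)) : ℝ :=
  (1 / (M : ℝ)) * ∑ m, (blockOutput N (C.enc m).op σ.op * (1 - C.dec m)).trace.re

/-- The average error probability of a code over the memoryless channel `T^{⊗ℓ}`. -/
def memorylessErrorProb (T : Op A →ₗ[ℂ] Op B) {ℓ M : ℕ} (C : Code A B ℓ M) : ℝ :=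
  (1 / (M : ℝ)) * ∑ m, (tensorPowMap T ℓ (C.enc m).op * (1 - C.dec m)).trace.re

/-- `C` has error probability at most `ε` for the compound channel `{𝒩_σ}`. -/
def HasCompoundError (N : Channel (A × J) B) {ℓ M : ℕ} (C : Code A B ℓ M) (ε : ℝ) : Prop :=
  ∀ σ : State J, memorylessErrorProb (fixJammer N σ) C ≤ ε

/-- `𝒩^{⊗ℓ} (ρ ⊗ σ^{⊗ℓ}) = (𝒩_σ)^{⊗ℓ} (ρ)`. -/
theorem blockOutput_pow (N : Channel (A × J) B) {ℓ : ℕ} (ρ : Op (Pow A ℓ)) (σ : State J) :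
    blockOutput N ρ (σ.pow ℓ).op = tensorPowMap (fixJammer N σ) ℓ ρ := by
  have key : ∀ (a a' : A) (b b' : B), fixJammer N σ (Matrix.single a a' 1) b b' =
      ∑ j, ∑ j', σ.op j j' * N.map (Matrix.single (a, j) (a', j') 1) b b' := by
    intro a a' b b'
    rw [fixJammer, LinearMap.coe_mk, AddHom.coe_mk, map_apply_eq_sum]
    simp only [Fintype.sum_prod_type, Matrix.kroneckerMap_apply, Matrix.single_apply]
    rw [Finset.sum_eq_single a (by intro x _ hx; simp [hx.symm]) (by simp)]
    refine Finset.sum_congr rfl fun j _ => ?_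
    rw [Finset.sum_eq_single a' (by intro x _ hx; simp [hx.symm]) (by simp)]
    simp
  ext b b'
  simp only [blockOutput, tensorPowMap, LinearMap.coe_mk, AddHom.coe_mk, Matrix.of_apply, key,
    prod_sum_sum]
  rw [← (Equiv.arrowProdEquivProdArrow (Fin ℓ) (fun _ => A) (fun _ => J)).symm.sum_comp]
  simp_rw [← (Equiv.arrowProdEquivProdArrow (Fin ℓ) (fun _ => A) (fun _ => J)).symm.sum_comp
    (fun x' => _ * ∏ i, _)]
  simp only [Fintype.sum_prod_type]
  refine Finset.sum_congr rfl fun a _ => ?_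
  rw [Finset.sum_comm]
  refine Finset.sum_congr rfl fun a' _ => ?_
  simp [Finset.mul_sum, State.pow, tensorOp, Equiv.arrowProdEquivProdArrow,
    Finset.prod_mul_distrib, mul_assoc]

theorem errorProb_pow (N : Channel (A × J) B) {ℓ M : ℕ} (C : Code A B ℓ M) (σ : State J) :
    errorProb N C (σ.pow ℓ) = memorylessErrorProb (fixJammer N σ) C := by
  simp only [errorProb, memorylessErrorProb, blockOutput_pow]

/-- A random code whose shared random variable takes values in a finite set. -/
structure RandomCode (Λ A B : Type*) [Fintype A] [Fintype B] [DecidableEq B] (ℓ M : ℕ) where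
  law : PMF Λ
  code : Λ → Code A B ℓ M

/-- The error probability of a random code with respect to a jammer state on `J^ℓ`: the
expectation of the error probabilities of its members. -/
def RandomCode.errorProb {Λ : Type*} [Fintype Λ] (N : Channel (A × J) B) {ℓ M : ℕ}
    (R : RandomCode Λ A B ℓ M) (σ : State (Pow J ℓ)) : ℝ :=
  ∑ l, (R.law l).toReal * QAVC.errorProb N (R.code l) σ

end

/-- The permutation operator `U^π` on `X^ℓ`, which maps the basis vector `x` to `x ∘ π⁻¹`. -/
def permOp (X : Type*) [DecidableEq X] {ℓ : ℕ} (π : Equiv.Perm (Fin ℓ)) : Op (Pow X ℓ) :=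
  Matrix.of fun y x => if y = x ∘ ⇑π⁻¹ then 1 else 0

/-- `U^π |α_1⟩ ⋯ |α_ℓ⟩ = |α_{π⁻¹(1)}⟩ ⋯ |α_{π⁻¹(ℓ)}⟩`. -/
theorem permOp_mulVec {X : Type*} [Fintype X] [DecidableEq X] {ℓ : ℕ}
    (π : Equiv.Perm (Fin ℓ)) (α : Fin ℓ → X → ℂ) :
    permOp X π *ᵥ (fun x => ∏ i, α i (x i)) = fun x => ∏ i, α (π⁻¹ i) (x i) := by
  ext y
  have h : ∀ x : Pow X ℓ, y = x ∘ ⇑π⁻¹ ↔ y ∘ ⇑π = x := fun x => by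
    constructor <;> rintro rfl <;> ext i <;> simp
  simp only [permOp, Matrix.mulVec, dotProduct, Matrix.of_apply, h, ite_mul, one_mul, zero_mul,
    Finset.sum_ite_eq, Finset.mem_univ, if_true, Function.comp_apply]
  exact Fintype.prod_equiv π _ _ (by simp)

theorem permOp_unitary {X : Type*} [Fintype X] [DecidableEq X] {ℓ : ℕ}
    (π : Equiv.Perm (Fin ℓ)) :
    (permOp X π)ᴴ * permOp X π = 1 ∧ permOp X π * (permOp X π)ᴴ = 1 := by
  have h1 : (permOp X π)ᴴ * permOp X π = 1 := by
    ext x x'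
    have h : x' ∘ ⇑π⁻¹ = x ∘ ⇑π⁻¹ ↔ x = x' :=
      (π⁻¹).surjective.injective_comp_right.eq_iff.trans eq_comm
    simp [permOp, Matrix.mul_apply, Matrix.conjTranspose_apply, Matrix.one_apply, apply_ite,
      -Equiv.Perm.coe_inv]
    split_ifs with hx
    · exact h.mpr hx
    · exact fun hh => hx (h.mp hh)
  exact ⟨h1, mul_eq_one_comm.mp h1⟩

/-- `U^π ρ U^{π†}` for a state `ρ`. -/
def State.permute {X : Type*} [Fintype X] [DecidableEq X] {ℓ : ℕ} (π : Equiv.Perm (Fin ℓ))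
    (ρ : State (Pow X ℓ)) : State (Pow X ℓ) where
  op := permOp X π * ρ.op * (permOp X π)ᴴ
  posSemidef := ρ.posSemidef.mul_mul_conjTranspose_same _
  trace_eq_one := by
    rw [Matrix.trace_mul_comm, ← mul_assoc, (permOp_unitary π).1, one_mul, ρ.trace_eq_one]

/-- The permuted code `𝒞_π`. -/
def Code.permute {A B : Type*} [Fintype A] [Fintype B] [DecidableEq A] [DecidableEq B]
    {ℓ M : ℕ} (C : Code A B ℓ M) (π : Equiv.Perm (Fin ℓ)) : Code A B ℓ M where
  enc m := (C.enc m).permute π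
  dec m := permOp B π * C.dec m * (permOp B π)ᴴ
  dec_posSemidef m := (C.dec_posSemidef m).mul_mul_conjTranspose_same _
  dec_sum := by
    rw [← Finset.sum_mul, ← Finset.mul_sum, C.dec_sum, mul_one, (permOp_unitary π).2]

/-- The random code `(𝒞_π)` with a uniformly distributed permutation `π` of `[ℓ]`. -/
def Code.randomPermute {A B : Type*} [Fintype A] [Fintype B] [DecidableEq A] [DecidableEq B]
    {ℓ M : ℕ} (C : Code A B ℓ M) : RandomCode (Equiv.Perm (Fin ℓ)) A B ℓ M where
  law := PMF.uniformOfFintype (Equiv.Perm (Fin ℓ))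
  code π := C.permute π

end

end QAVC

namespace QAVC

open MeasureTheory Finset
open scoped Nat ComplexConjugate

/-! ### Moments of the complex Gaussian in one variable -/

section GaussianMoments

/-! This is a post-selection argument. The error probability is a positive linear functional `F` of
the jammer's operator, and permuting the code is equivalent to permuting the jammer's systems
(`errorProb_permute`). Averaging over permutations therefore replaces `ζ` by its twirl. It remains
to bound `F` on permutation-invariant states by `ε` times the dimension of `Sym^ℓ(J ⊗ J)`
(`functional_permInvariant_le`).

Write the invariant state as `V Vᴴ`, where `V` is its square root. As a vector of `(J ⊗ J)^{⊗ℓ}`,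
`V` is a symmetric purification, and `F (V Vᴴ)` is a positive quadratic form `q(V)`. On `Φ^{⊗ℓ}` the
form equals `F ((Φ Φᴴ)^{⊗ℓ})`, so the i.i.d. hypothesis and homogeneity give `q(v^{⊗ℓ}) ≤ ε
‖v‖^{2ℓ}`.

The passage from tensor powers to all symmetric vectors (`sum_norm_sq_symmetric_le`) uses Gaussian
integration. With `K = J × J`, Wick's formula says that the integral of `exp(-‖v‖²)
|v^{⊗ℓ}⟩⟨v^{⊗ℓ}|` is `π^|K| ℓ!` times the projection onto the symmetric subspace, while the integral
of `exp(-‖v‖²) ‖v‖^{2ℓ}` is `π^|K| ℓ!` times its dimension. That dimension counts the types of words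
of length `ℓ` over `K`, of which there are at most `(ℓ+1)^|K|`. -/

theorem integral_norm_pow_mul_exp_neg_sq (n : ℕ) :
    ∫ z : ℂ, ‖z‖ ^ n * Real.exp (-‖z‖ ^ 2) = Real.pi * Real.Gamma ((n : ℝ) / 2 + 1) := by
  have h := Complex.integral_rpow_mul_exp_neg_rpow (p := 2) (q := n) (by norm_num)
    (by have : (0 : ℝ) ≤ n := n.cast_nonneg
        linarith)
  norm_cast at h
  rw [h]
  push_cast
  rw [add_div]
  norm_num

theorem integrable_norm_pow_mul_exp_neg_sq (n : ℕ) :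
    Integrable fun z : ℂ => ‖z‖ ^ n * Real.exp (-‖z‖ ^ 2) := by
  -- The integral of a non-integrable function is zero by convention, so a positive value proves
  -- integrability.
  apply Integrable.of_integral_ne_zero
  rw [integral_norm_pow_mul_exp_neg_sq]
  exact (mul_pos Real.pi_pos (Real.Gamma_pos_of_pos (by positivity))).ne'

/-- The monomial `z ^ s * conj z ^ t` weighted by the Gaussian `exp (-|z|²)`. -/
noncomputable def gaussMonomial (s t : ℕ) (z : ℂ) : ℂ :=
  (Real.exp (-‖z‖ ^ 2) : ℂ) * (z ^ s * conj z ^ t)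

theorem norm_gaussMonomial (s t : ℕ) (z : ℂ) :
    ‖gaussMonomial s t z‖ = ‖z‖ ^ (s + t) * Real.exp (-‖z‖ ^ 2) := by
  rw [gaussMonomial, norm_mul, norm_mul, norm_pow, norm_pow, RCLike.norm_conj, Complex.norm_real,
    Real.norm_eq_abs, Real.abs_exp, pow_add]
  ring

theorem integrable_gaussMonomial (s t : ℕ) : Integrable (gaussMonomial s t) := by
  have hc : Continuous (gaussMonomial s t) := by
    unfold gaussMonomial
    fun_prop
  exact (integrable_norm_pow_mul_exp_neg_sq (s + t)).mono' hc.aestronglyMeasurable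
    (.of_forall fun z => (norm_gaussMonomial s t z).le)

theorem gaussMonomial_self (s : ℕ) (z : ℂ) :
    gaussMonomial s s z = ((‖z‖ ^ (2 * s) * Real.exp (-‖z‖ ^ 2) : ℝ) : ℂ) := by
  rw [gaussMonomial, ← mul_pow, Complex.mul_conj']
  push_cast
  ring

theorem integral_gaussMonomial_self (s : ℕ) :
    ∫ z, gaussMonomial s s z = Real.pi * (s ! : ℂ) := by
  simp_rw [gaussMonomial_self]
  rw [integral_complex_ofReal, integral_norm_pow_mul_exp_neg_sq]
  push_cast
  rw [mul_div_cancel_left₀ _ (by norm_num : (2 : ℝ) ≠ 0), Real.Gamma_nat_eq_factorial]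
  norm_cast

theorem gaussMonomial_rotation (s t : ℕ) (c : Circle) (z : ℂ) :
    gaussMonomial s t (rotation c z) = ((c : ℂ) ^ s * conj (c : ℂ) ^ t) * gaussMonomial s t z := by
  simp only [gaussMonomial, rotation_apply, norm_mul, Circle.norm_coe, one_mul, map_mul, mul_pow]
  ring

theorem exists_circle_pow_mul_conj_pow_ne_one {s t : ℕ} (h : s ≠ t) :
    ∃ c : Circle, (c : ℂ) ^ s * conj (c : ℂ) ^ t ≠ 1 := by
  have h0 : (s : ℂ) - t ≠ 0 := sub_ne_zero.mpr (by exact_mod_cast h)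
  -- At angle `θ` the factor is `exp(i(s - t)θ)`; this angle makes it `-1`.
  refine ⟨Circle.exp (Real.pi / ((s : ℝ) - t)), ?_⟩
  have : ((Circle.exp (Real.pi / ((s : ℝ) - t)) : ℂ)) ^ s *
      conj (Circle.exp (Real.pi / ((s : ℝ) - t)) : ℂ) ^ t = -1 := by
    rw [Circle.coe_exp, ← Complex.exp_conj, ← Complex.exp_nat_mul, ← Complex.exp_nat_mul,
      ← Complex.exp_add, ← Complex.exp_pi_mul_I]
    congr 1
    simp only [map_mul, Complex.conj_ofReal, Complex.conj_I]
    push_cast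
    field_simp
    ring
  rw [this]
  norm_num

/-- Rotation preserves Lebesgue measure but multiplies the integrand by a phase, which can be chosen
different from `1`. -/
theorem integral_gaussMonomial_of_ne {s t : ℕ} (h : s ≠ t) : ∫ z, gaussMonomial s t z = 0 := by
  obtain ⟨c, hc⟩ := exists_circle_pow_mul_conj_pow_ne_one h
  have h1 : ∫ z, gaussMonomial s t (rotation c z) = ∫ z, gaussMonomial s t z :=
    (rotation c).measurePreserving.integral_comp
      (rotation c).toHomeomorph.measurableEmbedding _
  simp_rw [gaussMonomial_rotation] at h1
  rw [integral_const_mul] at h1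
  by_contra h2
  exact hc (mul_right_cancel₀ h2 (h1.trans (one_mul _).symm))

theorem integral_gaussMonomial (s t : ℕ) :
    ∫ z, gaussMonomial s t z = if s = t then Real.pi * (s ! : ℂ) else 0 := by
  split_ifs with h
  · rw [← h, integral_gaussMonomial_self]
  · exact integral_gaussMonomial_of_ne h

end GaussianMoments

/-! ### Wick's formula and the number of types -/

section Wick

variable {K : Type*} [Fintype K] [DecidableEq K]

/-- The Gaussian weight `exp (-∑ |v k|²)`. -/
noncomputable def gaussWeight (v : K → ℂ) : ℝ := ∏ k, Real.exp (-‖v k‖ ^ 2)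

omit [DecidableEq K] in
theorem gaussWeight_nonneg (v : K → ℂ) : 0 ≤ gaussWeight v :=
  prod_nonneg fun _ _ => (Real.exp_pos _).le

/-- The coordinates of the tensor power `v^{⊗ℓ}`. -/
def vecPow {ℓ : ℕ} (v : K → ℂ) (x : Pow K ℓ) : ℂ := ∏ i, v (x i)

/-- The number of occurrences of a letter in a word. -/
def occ {ℓ : ℕ} (x : Pow K ℓ) (k : K) : ℕ := #{i | x i = k}

theorem vecPow_eq_prod_pow_occ {ℓ : ℕ} (v : K → ℂ) (x : Pow K ℓ) :
    vecPow v x = ∏ k, v k ^ occ x k := by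
  rw [vecPow, ← prod_fiberwise_of_maps_to (g := x) (t := univ) (fun _ _ => mem_univ _)]
  refine prod_congr rfl fun k _ => ?_
  rw [occ, ← prod_const]
  exact prod_congr rfl fun i hi => by rw [(mem_filter.mp hi).2]

theorem gaussWeight_mul_vecPow {ℓ : ℕ} (x y : Pow K ℓ) (v : K → ℂ) :
    (gaussWeight v : ℂ) * (vecPow v x * conj (vecPow v y)) =
      ∏ k, gaussMonomial (occ x k) (occ y k) (v k) := by
  simp only [gaussWeight, vecPow_eq_prod_pow_occ, gaussMonomial, map_prod, map_pow,
    Complex.ofReal_prod, prod_mul_distrib]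

theorem integrable_gaussWeight_mul_vecPow {ℓ : ℕ} (x y : Pow K ℓ) :
    Integrable fun v : K → ℂ => (gaussWeight v : ℂ) * (vecPow v x * conj (vecPow v y)) := by
  simp_rw [gaussWeight_mul_vecPow]
  exact Integrable.fintype_prod fun k => integrable_gaussMonomial _ _

omit [Fintype K] in
theorem occ_comp_perm {ℓ : ℕ} (x : Pow K ℓ) (π : Equiv.Perm (Fin ℓ)) : occ (x ∘ π) = occ x := by
  ext k
  simp only [occ, Function.comp_apply]
  exact card_equiv π (by simp)

omit [Fintype K] in
-- For each letter, its sets of positions in the two words have equal size; bijections between them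
-- glue to a permutation.
theorem exists_perm_of_occ_eq {ℓ : ℕ} {x y : Pow K ℓ} (h : occ x = occ y) :
    ∃ π : Equiv.Perm (Fin ℓ), x ∘ π = y := by
  have e : ∀ k, Nonempty ({i // y i = k} ≃ {i // x i = k}) := fun k =>
    ⟨Fintype.equivOfCardEq (by simpa [Fintype.card_subtype, occ] using (congrFun h k).symm)⟩
  refine ⟨(Equiv.sigmaFiberEquiv y).symm.trans
    ((Equiv.sigmaCongrRight fun k => (e k).some).trans (Equiv.sigmaFiberEquiv x)), ?_⟩
  ext i
  exact ((e (y i)).some ⟨i, rfl⟩).2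

/-- The number of permutations taking one word to another. -/
theorem card_perm_comp_eq {ℓ : ℕ} (x y : Pow K ℓ) :
    #{π : Equiv.Perm (Fin ℓ) | x ∘ π = y} =
      if occ x = occ y then ∏ k, (occ x k)! else 0 := by
  split_ifs with h
  · obtain ⟨σ, rfl⟩ := exists_perm_of_occ_eq h
    -- The permutations in question form a coset of the stabilizer of `x`, whose order is the
    -- product of the factorials of the letter counts.
    have := DomMulAct.stabilizer_card x
    simp only [Fintype.card_subtype] at this
    simp only [occ]
    rw [← this]
    refine card_equiv (Equiv.mulRight σ⁻¹) fun π => ?_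
    simp only [mem_filter, mem_univ, true_and, Equiv.coe_mulRight]
    constructor
    · intro hπ
      rw [Equiv.Perm.coe_mul, ← Function.comp_assoc, hπ]
      ext i
      simp
    · intro hπ
      nth_rewrite 2 [← hπ]
      ext i
      simp
  · rw [card_eq_zero, filter_eq_empty_iff]
    rintro π - rfl
    exact h (occ_comp_perm x π).symm

/-- Wick's formula: the Gaussian moments count permutations. -/
theorem integral_gaussWeight_mul_vecPow {ℓ : ℕ} (x y : Pow K ℓ) :
    ∫ v : K → ℂ, (gaussWeight v : ℂ) * (vecPow v x * conj (vecPow v y)) =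
      Real.pi ^ Fintype.card K * (#{π : Equiv.Perm (Fin ℓ) | x ∘ π = y} : ℂ) := by
  simp_rw [gaussWeight_mul_vecPow]
  rw [integral_fintype_prod_volume_eq_prod, card_perm_comp_eq]
  simp_rw [integral_gaussMonomial]
  split_ifs with h
  · simp [h, prod_mul_distrib]
  · obtain ⟨k, hk⟩ := Function.ne_iff.mp h
    rw [prod_eq_zero (mem_univ k) (if_neg hk)]
    simp

theorem gaussWeight_mul_sum_pow (ℓ : ℕ) (v : K → ℂ) :
    gaussWeight v * (∑ k, ‖v k‖ ^ 2) ^ ℓ = ∑ t ∈ piAntidiag univ ℓ,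
      (Nat.multinomial univ t : ℝ) * ∏ k, (‖v k‖ ^ (2 * t k) * Real.exp (-‖v k‖ ^ 2)) := by
  rw [sum_pow_eq_sum_piAntidiag, mul_sum]
  refine sum_congr rfl fun t _ => ?_
  rw [prod_mul_distrib, gaussWeight]
  simp_rw [pow_mul]
  ring

theorem integrable_gaussWeight_mul_sum_pow (ℓ : ℕ) :
    Integrable fun v : K → ℂ => gaussWeight v * (∑ k, ‖v k‖ ^ 2) ^ ℓ := by
  simp_rw [gaussWeight_mul_sum_pow]
  exact integrable_finsetSum _ fun t _ => .const_mul
    (Integrable.fintype_prod (f := fun k (z : ℂ) => ‖z‖ ^ (2 * t k) * Real.exp (-‖z‖ ^ 2))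
      fun k => integrable_norm_pow_mul_exp_neg_sq _) _

/-- In the multinomial expansion every type `t` contributes the same amount: the moments give `∏ (t
k)!`, which cancels the denominator of the multinomial coefficient and leaves `ℓ!`. -/
theorem integral_gaussWeight_mul_sum_pow (ℓ : ℕ) :
    ∫ v : K → ℂ, gaussWeight v * (∑ k, ‖v k‖ ^ 2) ^ ℓ =
      Real.pi ^ Fintype.card K * (ℓ ! * #(piAntidiag (univ : Finset K) ℓ)) := by
  simp_rw [gaussWeight_mul_sum_pow]
  rw [integral_finsetSum _ fun t _ => .const_mul
    (Integrable.fintype_prod (f := fun k (z : ℂ) => ‖z‖ ^ (2 * t k) * Real.exp (-‖z‖ ^ 2))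
      fun k => integrable_norm_pow_mul_exp_neg_sq _) _]
  have : ∀ t ∈ piAntidiag (univ : Finset K) ℓ, ∫ v : K → ℂ, (Nat.multinomial univ t : ℝ) *
      ∏ k, (‖v k‖ ^ (2 * t k) * Real.exp (-‖v k‖ ^ 2)) = Real.pi ^ Fintype.card K * ℓ ! := by
    intro t ht
    rw [integral_const_mul, integral_fintype_prod_volume_eq_prod
      (fun k (z : ℂ) => ‖z‖ ^ (2 * t k) * Real.exp (-‖z‖ ^ 2))]
    simp_rw [integral_norm_pow_mul_exp_neg_sq]
    push_cast
    simp_rw [mul_div_cancel_left₀ _ (by norm_num : (2 : ℝ) ≠ 0), Real.Gamma_nat_eq_factorial]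
    rw [prod_mul_distrib, prod_const, ← (mem_piAntidiag.mp ht).1, ← Nat.multinomial_spec]
    push_cast
    rw [card_univ]
    ring
  rw [sum_congr rfl this, sum_const, nsmul_eq_mul]
  ring

theorem card_piAntidiag_univ_le (ℓ : ℕ) :
    #(piAntidiag (univ : Finset K) ℓ) ≤ (ℓ + 1) ^ Fintype.card K := by
  calc #(piAntidiag (univ : Finset K) ℓ)
      ≤ #(Fintype.piFinset fun _ : K => range (ℓ + 1)) := by
        refine card_le_card fun t ht => Fintype.mem_piFinset.mpr fun k => ?_
        rw [mem_range, Nat.lt_succ_iff, ← (mem_piAntidiag.mp ht).1]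
        exact single_le_sum (f := t) (fun _ _ => Nat.zero_le _) (mem_univ k)
    _ = (ℓ + 1) ^ Fintype.card K := by simp [Fintype.card_piFinset]

end Wick

/-! ### From tensor powers to symmetric vectors -/

section SymmetricVectors

variable {K : Type*} [Fintype K] [DecidableEq K] {ℓ : ℕ}

omit [DecidableEq K] in
theorem sum_comp_perm {M : Type*} [AddCommMonoid M] (π : Equiv.Perm (Fin ℓ))
    (f : Pow K ℓ → M) : ∑ x, f (x ∘ π) = ∑ x, f x :=
  (Equiv.arrowCongr π⁻¹ (Equiv.refl K)).sum_comp f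

/-- The sum of all permutations of a vector. -/
def permSum (w : Pow K ℓ → ℂ) (x : Pow K ℓ) : ℂ := ∑ π : Equiv.Perm (Fin ℓ), w (x ∘ π)

omit [DecidableEq K] in
theorem factorial_mul_sum_mul_eq (w ψ : Pow K ℓ → ℂ)
    (hψ : ∀ (π : Equiv.Perm (Fin ℓ)) x, ψ (x ∘ π) = ψ x) :
    (ℓ ! : ℂ) * ∑ x, w x * ψ x = ∑ x, permSum w x * ψ x := by
  simp_rw [permSum, sum_mul]
  rw [sum_comm]
  have : ∀ π : Equiv.Perm (Fin ℓ), ∑ x, w (x ∘ π) * ψ x = ∑ x, w x * ψ x := fun π => by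
    rw [← sum_comp_perm π fun x => w x * ψ x]
    simp_rw [hψ]
  simp [this, Fintype.card_perm]

/-- Symmetrization is `ℓ!` times an orthogonal projection, so the squared norm of `permSum w` is
`ℓ!` times the quadratic form of `permSum` at `w`. Its kernel is the permutation count of Wick's
formula. -/
theorem sum_permSum_mul_conj (w : Pow K ℓ → ℂ) :
    ∑ x, permSum w x * conj (permSum w x) = ℓ ! * ∑ x, ∑ y, w x * conj (w y) *
      (#{π : Equiv.Perm (Fin ℓ) | x ∘ π = y} : ℂ) := by
  have h1 : ∀ π : Equiv.Perm (Fin ℓ), ∑ x, w (x ∘ π) * conj (permSum w x) =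
      ∑ x, w x * conj (permSum w x) := fun π => by
    rw [← sum_comp_perm π fun x => w x * conj (permSum w x)]
    refine sum_congr rfl fun x _ => ?_
    congr 2
    simp only [permSum, Function.comp_assoc]
    exact (Equiv.sum_comp (Equiv.mulLeft π) fun σ : Equiv.Perm (Fin ℓ) => w (x ∘ σ)).symm
  have h2 : ∀ x, permSum w x =
      ∑ y, w y * (#{π : Equiv.Perm (Fin ℓ) | x ∘ π = y} : ℂ) := fun x => by
    rw [permSum, ← sum_fiberwise_of_maps_to (g := fun π : Equiv.Perm (Fin ℓ) => x ∘ π) (t := univ)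
      (fun _ _ => mem_univ _)]
    refine sum_congr rfl fun y _ => ?_
    rw [sum_congr rfl fun π hπ => by rw [(mem_filter.mp hπ).2], sum_const, nsmul_eq_mul, mul_comm]
  calc ∑ x, permSum w x * conj (permSum w x)
      = ∑ π : Equiv.Perm (Fin ℓ), ∑ x, w (x ∘ π) * conj (permSum w x) := by
        rw [sum_comm]
        exact sum_congr rfl fun x _ => by rw [← sum_mul]; rfl
    _ = ℓ ! * ∑ x, w x * conj (permSum w x) := by
        simp [h1, Fintype.card_perm]
    _ = _ := by
        congr 1
        refine sum_congr rfl fun x _ => ?_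
        rw [h2, map_sum, mul_sum]
        simp [mul_assoc]

omit [DecidableEq K] in
theorem ofReal_gaussWeight_mul_norm_sq (w : Pow K ℓ → ℂ) (v : K → ℂ) :
    ((gaussWeight v * ‖∑ x, w x * vecPow v x‖ ^ 2 : ℝ) : ℂ) = ∑ x, ∑ y, (w x * conj (w y)) *
      ((gaussWeight v : ℂ) * (vecPow v x * conj (vecPow v y))) := by
  push_cast
  rw [← Complex.mul_conj', map_sum, sum_mul_sum, mul_sum]
  refine sum_congr rfl fun x _ => ?_
  rw [mul_sum]
  refine sum_congr rfl fun y _ => ?_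
  rw [map_mul]
  ring

/-- The Gaussian average of `|⟨w, v^{⊗ℓ}⟩|²`. -/
theorem integral_gaussWeight_mul_norm_sq (w : Pow K ℓ → ℂ) :
    ((∫ v : K → ℂ, gaussWeight v * ‖∑ x, w x * vecPow v x‖ ^ 2 : ℝ) : ℂ) =
      Real.pi ^ Fintype.card K * ∑ x, ∑ y, w x * conj (w y) *
        (#{π : Equiv.Perm (Fin ℓ) | x ∘ π = y} : ℂ) := by
  rw [← integral_complex_ofReal]
  simp_rw [ofReal_gaussWeight_mul_norm_sq]
  have hi := fun x y : Pow K ℓ => (integrable_gaussWeight_mul_vecPow x y).const_mul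
    (w x * conj (w y))
  rw [integral_finsetSum _ fun x _ => integrable_finsetSum _ fun y _ => hi x y, mul_sum]
  refine sum_congr rfl fun x _ => ?_
  rw [integral_finsetSum _ fun y _ => hi x y, mul_sum]
  refine sum_congr rfl fun y _ => ?_
  rw [integral_const_mul, integral_gaussWeight_mul_vecPow]
  ring

theorem integrable_gaussWeight_mul_norm_sq (w : Pow K ℓ → ℂ) :
    Integrable fun v : K → ℂ => gaussWeight v * ‖∑ x, w x * vecPow v x‖ ^ 2 := by
  have h := (integrable_finsetSum univ fun x _ => integrable_finsetSum univ fun y _ =>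
    (integrable_gaussWeight_mul_vecPow x y).const_mul (w x * conj (w y))).re
  simp_rw [← ofReal_gaussWeight_mul_norm_sq] at h
  exact h

theorem norm_sum_mul_sq_le {ι : Type*} (s : Finset ι) (a b : ι → ℂ) :
    ‖∑ x ∈ s, a x * b x‖ ^ 2 ≤ (∑ x ∈ s, ‖a x‖ ^ 2) * ∑ x ∈ s, ‖b x‖ ^ 2 := by
  calc ‖∑ x ∈ s, a x * b x‖ ^ 2 ≤ (∑ x ∈ s, ‖a x‖ * ‖b x‖) ^ 2 := by
        gcongr
        exact (norm_sum_le _ _).trans_eq (sum_congr rfl fun _ _ => norm_mul _ _)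
    _ ≤ _ := sum_mul_sq_le_sq_mul_sq _ _ _

/-- The overlap with a symmetric vector is bounded by the Gaussian average of the
overlaps with tensor powers. -/
theorem norm_sum_mul_symmetric_sq_le (w ψ : Pow K ℓ → ℂ)
    (hψ : ∀ (π : Equiv.Perm (Fin ℓ)) x, ψ (x ∘ π) = ψ x) :
    Real.pi ^ Fintype.card K * ℓ ! * ‖∑ x, w x * ψ x‖ ^ 2 ≤
      (∫ v : K → ℂ, gaussWeight v * ‖∑ x, w x * vecPow v x‖ ^ 2) * ∑ x, ‖ψ x‖ ^ 2 := by
  have h1 : Real.pi ^ Fintype.card K * ∑ x, ‖permSum w x‖ ^ 2 =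
      ℓ ! * ∫ v : K → ℂ, gaussWeight v * ‖∑ x, w x * vecPow v x‖ ^ 2 := by
    apply Complex.ofReal_injective
    rw [Complex.ofReal_mul, Complex.ofReal_mul, integral_gaussWeight_mul_norm_sq]
    push_cast
    simp_rw [← Complex.mul_conj']
    rw [sum_permSum_mul_conj]
    ring
  -- Only the symmetric part of `w` pairs with `ψ`, so Cauchy–Schwarz is applied after symmetrizing
  -- `w`.
  have h2 : (ℓ ! : ℝ) ^ 2 * ‖∑ x, w x * ψ x‖ ^ 2 ≤
      (∑ x, ‖permSum w x‖ ^ 2) * ∑ x, ‖ψ x‖ ^ 2 := by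
    have := norm_sum_mul_sq_le univ (permSum w) ψ
    rwa [← factorial_mul_sum_mul_eq w ψ hψ, norm_mul, mul_pow, Complex.norm_natCast] at this
  have hpos : (0 : ℝ) < ℓ ! := by exact_mod_cast Nat.factorial_pos ℓ
  have hpi : 0 ≤ Real.pi ^ Fintype.card K := pow_nonneg Real.pi_pos.le _
  refine le_of_mul_le_mul_left ?_ hpos
  calc (ℓ ! : ℝ) * (Real.pi ^ Fintype.card K * ℓ ! * ‖∑ x, w x * ψ x‖ ^ 2)
      = Real.pi ^ Fintype.card K * ((ℓ ! : ℝ) ^ 2 * ‖∑ x, w x * ψ x‖ ^ 2) := by ring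
    _ ≤ Real.pi ^ Fintype.card K * ((∑ x, ‖permSum w x‖ ^ 2) * ∑ x, ‖ψ x‖ ^ 2) := by gcongr
    _ = (ℓ ! * ∫ v : K → ℂ, gaussWeight v * ‖∑ x, w x * vecPow v x‖ ^ 2) *
          ∑ x, ‖ψ x‖ ^ 2 := by rw [← h1]; ring
    _ = _ := by ring

/-- A positive quadratic form that is small on tensor powers is small on symmetric vectors, up to
the dimension of the symmetric subspace. -/
theorem sum_norm_sq_symmetric_le {ι : Type*} [Fintype ι] (W : ι → Pow K ℓ → ℂ) {ε : ℝ}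
    (hW : ∀ v : K → ℂ, ∑ r, ‖∑ x, W r x * vecPow v x‖ ^ 2 ≤ ε * (∑ k, ‖v k‖ ^ 2) ^ ℓ)
    (ψ : Pow K ℓ → ℂ) (hψ : ∀ (π : Equiv.Perm (Fin ℓ)) x, ψ (x ∘ π) = ψ x) :
    ∑ r, ‖∑ x, W r x * ψ x‖ ^ 2 ≤ ε * #(piAntidiag (univ : Finset K) ℓ) * ∑ x, ‖ψ x‖ ^ 2 := by
  have hc : 0 < Real.pi ^ Fintype.card K * ℓ ! :=
    mul_pos (pow_pos Real.pi_pos _) (by exact_mod_cast Nat.factorial_pos ℓ)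
  refine le_of_mul_le_mul_left ?_ hc
  calc Real.pi ^ Fintype.card K * ℓ ! * ∑ r, ‖∑ x, W r x * ψ x‖ ^ 2
      ≤ ∑ r, (∫ v : K → ℂ, gaussWeight v * ‖∑ x, W r x * vecPow v x‖ ^ 2) *
          ∑ x, ‖ψ x‖ ^ 2 := by
        rw [mul_sum]
        exact sum_le_sum fun r _ => norm_sum_mul_symmetric_sq_le (W r) ψ hψ
    _ = (∫ v : K → ℂ, gaussWeight v * ∑ r, ‖∑ x, W r x * vecPow v x‖ ^ 2) *
          ∑ x, ‖ψ x‖ ^ 2 := by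
        rw [← sum_mul, ← integral_finsetSum _ fun r _ => integrable_gaussWeight_mul_norm_sq (W r)]
        simp_rw [mul_sum]
    _ ≤ (∫ v : K → ℂ, ε * (gaussWeight v * (∑ k, ‖v k‖ ^ 2) ^ ℓ)) * ∑ x, ‖ψ x‖ ^ 2 := by
        refine mul_le_mul_of_nonneg_right (integral_mono ?_ ?_ fun v => ?_)
          (sum_nonneg fun _ _ => sq_nonneg _)
        · simp_rw [mul_sum]
          exact integrable_finsetSum _ fun r _ => integrable_gaussWeight_mul_norm_sq (W r)
        · exact (integrable_gaussWeight_mul_sum_pow ℓ).const_mul ε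
        · calc gaussWeight v * ∑ r, ‖∑ x, W r x * vecPow v x‖ ^ 2
              ≤ gaussWeight v * (ε * (∑ k, ‖v k‖ ^ 2) ^ ℓ) :=
                mul_le_mul_of_nonneg_left (hW v) (gaussWeight_nonneg v)
            _ = _ := by ring
    _ = _ := by
        rw [integral_const_mul, integral_gaussWeight_mul_sum_pow]
        ring

end SymmetricVectors

/-! ### Positive functionals as sums of squares -/

section PositiveFunctionals

theorem posSemidef_of_dotProduct_mulVec_nonneg {X : Type*} [Fintype X] {P : Op X}
    (h : ∀ v : X → ℂ, 0 ≤ star v ⬝ᵥ (P *ᵥ v)) : P.PosSemidef := by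
  classical
  rw [← Matrix.isPositive_toEuclideanLin_iff, LinearMap.isPositive_iff_complex]
  intro v
  have hv : inner ℂ (P.toEuclideanLin v) v = star (star v.ofLp ⬝ᵥ (P *ᵥ v.ofLp)) := by
    rw [← inner_conj_symm, EuclideanSpace.inner_eq_star_dotProduct, dotProduct_comm]
    rfl
  obtain ⟨h1, h2⟩ := Complex.nonneg_iff.mp (star_nonneg_iff.mpr (h v.ofLp))
  rw [hv]
  exact ⟨Complex.ext rfl h2, h1⟩

theorem functional_apply_eq_sum {X : Type*} [Fintype X] [DecidableEq X] (F : Op X →ₗ[ℂ] ℂ)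
    (P : Op X) : F P = ∑ x, ∑ y, P x y * F (Matrix.single x y 1) := by
  conv_lhs => rw [Matrix.matrix_eq_sum_single P]
  simp only [map_sum]
  refine sum_congr rfl fun x _ => sum_congr rfl fun y _ => ?_
  have : Matrix.single x y (P x y) = P x y • Matrix.single x y (1 : ℂ) := by simp
  rw [this, map_smul, smul_eq_mul]

/-- A positive functional on operators is a sum of squares. -/
theorem exists_functional_eq_sum_norm_sq {X : Type*} [Fintype X] (F : Op X →ₗ[ℂ] ℂ)
    (hF : ∀ P : Op X, P.PosSemidef → 0 ≤ F P) :
    ∃ S : Op X, ∀ V : Op X, F (V * Vᴴ) = ((∑ r, ∑ z, ‖∑ x, S r x * V x z‖ ^ 2 : ℝ) : ℂ) := by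
  classical
  -- The indices are transposed so that the quadratic form of this matrix at `v` is `F` of the
  -- rank-one operator `v vᴴ`.
  have hE : (Matrix.of fun y x => F (Matrix.single x y 1) : Op X).PosSemidef := by
    refine posSemidef_of_dotProduct_mulVec_nonneg fun v => ?_
    have := hF _ (Matrix.posSemidef_vecMulVec_self_star v)
    rw [functional_apply_eq_sum] at this
    convert this using 1
    simp only [dotProduct, Matrix.mulVec, mul_sum, Matrix.vecMulVec_apply, Matrix.of_apply]
    rw [sum_comm]
    exact sum_congr rfl fun x _ => sum_congr rfl fun y _ => by ring
  obtain ⟨S, hS⟩ := exists_eq_conjTranspose_mul_self hE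
  refine ⟨S, fun V => ?_⟩
  have hS' : ∀ x y, F (Matrix.single x y 1) = ∑ r, conj (S r y) * S r x := fun x y =>
    congrFun (congrFun hS y) x
  rw [functional_apply_eq_sum]
  push_cast
  simp_rw [← Complex.mul_conj', hS', Matrix.mul_apply, Matrix.conjTranspose_apply, map_sum,
    sum_mul_sum, map_mul]
  calc ∑ x, ∑ y, ∑ z, ∑ r, V x z * star (V y z) * (conj (S r y) * S r x)
      = ∑ x, ∑ y, ∑ r, ∑ z, V x z * star (V y z) * (conj (S r y) * S r x) :=
        sum_congr rfl fun x _ => sum_congr rfl fun y _ => sum_comm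
    _ = ∑ x, ∑ r, ∑ y, ∑ z, V x z * star (V y z) * (conj (S r y) * S r x) :=
        sum_congr rfl fun x _ => sum_comm
    _ = ∑ r, ∑ x, ∑ y, ∑ z, V x z * star (V y z) * (conj (S r y) * S r x) := sum_comm
    _ = ∑ r, ∑ x, ∑ z, ∑ y, V x z * star (V y z) * (conj (S r y) * S r x) :=
        sum_congr rfl fun r _ => sum_congr rfl fun x _ => sum_comm
    _ = ∑ r, ∑ z, ∑ x, ∑ y, V x z * star (V y z) * (conj (S r y) * S r x) :=
        sum_congr rfl fun r _ => sum_comm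
    _ = _ := sum_congr rfl fun r _ => sum_congr rfl fun z _ => sum_congr rfl fun x _ =>
        sum_congr rfl fun y _ => by
          rw [← starRingEnd_apply]
          ring

end PositiveFunctionals

/-! ### Permutation operators and invariant square roots -/

section Permutations

variable {X : Type*} [Fintype X] [DecidableEq X] {ℓ : ℕ}

omit [Fintype X] in
theorem permOp_apply (π : Equiv.Perm (Fin ℓ)) (y x : Pow X ℓ) :
    permOp X π y x = if y ∘ π = x then 1 else 0 := by
  have h : y = x ∘ ⇑π⁻¹ ↔ y ∘ π = x := by
    constructor <;> rintro rfl <;> ext i <;> simp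
  simp only [permOp, Matrix.of_apply, h]

theorem permOp_mul_apply (π : Equiv.Perm (Fin ℓ)) (P : Op (Pow X ℓ)) (x y : Pow X ℓ) :
    (permOp X π * P) x y = P (x ∘ π) y := by
  simp [Matrix.mul_apply, permOp_apply]

theorem mul_permOp_conjTranspose_apply (π : Equiv.Perm (Fin ℓ)) (P : Op (Pow X ℓ))
    (x y : Pow X ℓ) : (P * (permOp X π)ᴴ) x y = P x (y ∘ π) := by
  simp [Matrix.mul_apply, permOp_apply, apply_ite]

theorem permOp_conj_apply (π : Equiv.Perm (Fin ℓ)) (P : Op (Pow X ℓ)) (x y : Pow X ℓ) :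
    (permOp X π * P * (permOp X π)ᴴ) x y = P (x ∘ π) (y ∘ π) := by
  rw [mul_permOp_conjTranspose_apply, permOp_mul_apply]

theorem permOp_conj_eq_iff_commute (π : Equiv.Perm (Fin ℓ)) (P : Op (Pow X ℓ)) :
    permOp X π * P * (permOp X π)ᴴ = P ↔ Commute P (permOp X π) := by
  obtain ⟨h1, h2⟩ := permOp_unitary (X := X) π
  rw [Commute, SemiconjBy]
  constructor
  · intro h
    conv_lhs => rw [← h, mul_assoc, h1, mul_one]
  · intro h
    rw [← h, mul_assoc, h2, mul_one]

open scoped MatrixOrder in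
/-- Permutation invariant positive operators have permutation invariant square roots. -/
theorem exists_permInvariant_sqrt {P : Op (Pow X ℓ)} (hP : P.PosSemidef)
    (hsymm : ∀ π : Equiv.Perm (Fin ℓ), permOp X π * P * (permOp X π)ᴴ = P) :
    ∃ V : Op (Pow X ℓ), P = V * Vᴴ ∧
      ∀ (π : Equiv.Perm (Fin ℓ)) x y, V (x ∘ π) (y ∘ π) = V x y := by
  have hpos : (CFC.sqrt P).PosSemidef := Matrix.nonneg_iff_posSemidef.mp (CFC.sqrt_nonneg P)
  -- Functional calculus: whatever commutes with `P` commutes with its square root.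
  have hcomm : ∀ π : Equiv.Perm (Fin ℓ), Commute (CFC.sqrt P) (permOp X π) := fun π =>
    ((permOp_conj_eq_iff_commute π P).mp (hsymm π)).cfcₙ_nnreal _
  have hsq : CFC.sqrt P * CFC.sqrt P = P := CFC.sqrt_mul_sqrt_self P hP.nonneg
  generalize CFC.sqrt P = V at hpos hcomm hsq
  refine ⟨V, by rw [hpos.isHermitian, hsq], fun π x y => ?_⟩
  rw [← permOp_conj_apply π V, (permOp_conj_eq_iff_commute π V).mpr (hcomm π)]

end Permutations

/-! ### Post-selection for positive functionals -/

section PostSelection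

variable {J : Type*} [Fintype J] {ℓ : ℕ}

theorem trace_self_mul_conjTranspose {X : Type*} [Fintype X] (V : Op X) :
    (V * Vᴴ).trace = ((∑ x, ∑ y, ‖V x y‖ ^ 2 : ℝ) : ℂ) := by
  simp [Matrix.trace, Matrix.mul_apply, ← Complex.mul_conj']

/-- The state `V Vᴴ / tr (V Vᴴ)`. -/
noncomputable def State.ofFactor (V : Op J) (hV : ∑ x, ∑ y, ‖V x y‖ ^ 2 ≠ 0) : State J where
  op := (((∑ x, ∑ y, ‖V x y‖ ^ 2)⁻¹ : ℝ) : ℂ) • (V * Vᴴ)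
  posSemidef := (Matrix.posSemidef_self_mul_conjTranspose V).smul
    (Complex.zero_le_real.mpr (by positivity))
  trace_eq_one := by
    rw [Matrix.trace_smul, trace_self_mul_conjTranspose, smul_eq_mul, ← Complex.ofReal_mul,
      inv_mul_cancel₀ hV, Complex.ofReal_one]

instance [Nonempty J] : Nonempty (State J) := by
  classical
  refine ⟨State.ofFactor 1 ?_⟩
  simp [Matrix.one_apply, apply_ite]

omit [Fintype J] in
theorem tensorOp_smul (c : ℂ) (P : Op J) :
    tensorOp (fun _ : Fin ℓ => c • P) = c ^ ℓ • tensorOp fun _ : Fin ℓ => P := by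
  ext x y
  simp [tensorOp, prod_mul_distrib]

/-- A bound on i.i.d. states extends to tensor powers of positive operators by homogeneity. -/
theorem functional_tensorOp_le [Nonempty J] (F : Op (Pow J ℓ) →ₗ[ℂ] ℂ) {ε : ℝ}
    (hε : ∀ σ : State J, (F (σ.pow ℓ).op).re ≤ ε) (V : Op J) :
    (F (tensorOp fun _ => V * Vᴴ)).re ≤ ε * (∑ x, ∑ y, ‖V x y‖ ^ 2) ^ ℓ := by
  by_cases hV : ∑ x, ∑ y, ‖V x y‖ ^ 2 = 0
  -- `V = 0` cannot be normalized. For `ℓ = 0` the bound reads `ε · 0 ^ 0 = ε`, and the empty tensor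
  -- product agrees with that of any state.
  · rcases ℓ.eq_zero_or_pos with rfl | hℓ
    · obtain ⟨σ⟩ := (inferInstance : Nonempty (State J))
      convert hε σ using 1
      · congr 2
      · simp
    · have h0 : V = 0 := by
        ext x y
        have h1 := (sum_eq_zero_iff_of_nonneg fun x _ => sum_nonneg fun y _ =>
          sq_nonneg ‖V x y‖).mp hV x (mem_univ x)
        have h2 := (sum_eq_zero_iff_of_nonneg fun y _ => sq_nonneg ‖V x y‖).mp h1 y (mem_univ y)
        simpa using h2
      have h3 := tensorOp_smul (ℓ := ℓ) (0 : ℂ) (V * Vᴴ)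
      rw [h0] at h3 ⊢
      simp only [zero_mul, smul_zero, zero_pow hℓ.ne', zero_smul] at h3
      simp [h3, zero_pow hℓ.ne']
  · have h1 : V * Vᴴ = ((∑ x, ∑ y, ‖V x y‖ ^ 2 : ℝ) : ℂ) • (State.ofFactor V hV).op := by
      rw [State.ofFactor, smul_smul, ← Complex.ofReal_mul, mul_inv_cancel₀ hV, Complex.ofReal_one,
        one_smul]
    have h2 := hε (State.ofFactor V hV)
    rw [h1, tensorOp_smul, map_smul, smul_eq_mul, ← Complex.ofReal_pow, Complex.re_ofReal_mul,
      mul_comm]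
    exact mul_le_mul_of_nonneg_right h2 (by positivity)

/-- Post-selection: a positive functional bounded by `ε` on i.i.d. states is bounded on
permutation invariant states by `ε` times the dimension of the symmetric subspace
of `(J ⊗ J)^{⊗ℓ}`. -/
theorem functional_permInvariant_le [DecidableEq J] [Nonempty J] (F : Op (Pow J ℓ) →ₗ[ℂ] ℂ)
    (hF : ∀ P : Op (Pow J ℓ), P.PosSemidef → 0 ≤ F P) {ε : ℝ}
    (hε : ∀ σ : State J, (F (σ.pow ℓ).op).re ≤ ε) (ζ : State (Pow J ℓ))
    (hζ : ∀ π : Equiv.Perm (Fin ℓ), permOp J π * ζ.op * (permOp J π)ᴴ = ζ.op) :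
    (F ζ.op).re ≤ ε * #(piAntidiag (univ : Finset (J × J)) ℓ) := by
  obtain ⟨S, hS⟩ := exists_functional_eq_sum_norm_sq F hF
  obtain ⟨V, hV, hVsymm⟩ := exists_permInvariant_sqrt ζ.posSemidef hζ
  let e := Equiv.arrowProdEquivProdArrow (Fin ℓ) (fun _ => J) (fun _ => J)
  -- These are the rows of `S ⊗ 1`, acting on an operator read as a vector of `(J ⊗ J)^{⊗ℓ}`.
  let W : Pow J ℓ × Pow J ℓ → Pow (J × J) ℓ → ℂ := fun r u =>
    if (e u).2 = r.2 then S r.1 (e u).1 else 0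
  have hW : ∀ (r : Pow J ℓ × Pow J ℓ) (U : Op (Pow J ℓ)),
      ∑ u, W r u * U (e u).1 (e u).2 = ∑ x, S r.1 x * U x r.2 := fun r U => by
    rw [e.sum_comp fun p : Pow J ℓ × Pow J ℓ => (if p.2 = r.2 then S r.1 p.1 else 0) * U p.1 p.2,
      Fintype.sum_prod_type]
    simp
  have hFW : ∀ U : Op (Pow J ℓ), (F (U * Uᴴ)).re =
      ∑ r, ‖∑ u, W r u * U (e u).1 (e u).2‖ ^ 2 := fun U => by
    simp only [hS, Complex.ofReal_re, hW, Fintype.sum_prod_type]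
  have key := sum_norm_sq_symmetric_le (ε := ε) W (fun v => ?_) (fun u => V (e u).1 (e u).2)
    fun π u => hVsymm π (e u).1 (e u).2
  · rw [← hFW, ← hV] at key
    refine key.trans_eq ?_
    have h1 := ζ.trace_eq_one
    rw [hV, trace_self_mul_conjTranspose] at h1
    rw [e.sum_comp fun p : Pow J ℓ × Pow J ℓ => ‖V p.1 p.2‖ ^ 2, Fintype.sum_prod_type,
      Complex.ofReal_eq_one.mp h1, mul_one]
  -- Under the same identification `v^{⊗ℓ}` is `Φ^{⊗ℓ}`, and `‖v‖²` is `tr (Φ Φᴴ)`.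
  · let Φ : Op J := Matrix.of fun x y => v (x, y)
    have h1 := functional_tensorOp_le F hε Φ
    rw [← tensorOp_mul, ← tensorOp_conjTranspose, hFW] at h1
    rw [Fintype.sum_prod_type (fun k : J × J => ‖v k‖ ^ 2)]
    exact h1

end PostSelection

/-! ### Tensor powers of completely positive maps -/

section CompletePositivity

/-- The Choi matrix of a linear map. -/
def choi {X Y : Type*} [DecidableEq X] (T : Op X →ₗ[ℂ] Op Y) : Op (X × Y) :=
  Matrix.of fun p q => T (Matrix.single p.1 q.1 1) p.2 q.2

/-- Up to relabelling, the Choi matrix is the image under `id ⊗ T` of the unnormalized maximally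
entangled projector, given here by the vector `w`. -/
theorem choi_posSemidef {X Y : Type*} [Fintype X] [DecidableEq X] [Fintype Y]
    {T : Op X →ₗ[ℂ] Op Y} (hT : IsCompletelyPositive T) : (choi T).PosSemidef := by
  let e := Fintype.equivFin X
  let w : Fin (Fintype.card X) × X → ℂ := fun p => if e p.2 = p.1 then 1 else 0
  have h := (hT _ _ (Matrix.posSemidef_vecMulVec_self_star w)).submatrix
    fun p : X × Y => (e p.1, p.2)
  have hw : ∀ z z' : X, Matrix.single z z' (1 : ℂ) =
      Matrix.of fun x x' => Matrix.vecMulVec w (star w) (e z, x) (e z', x') := fun z z' => by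
    ext x x'
    by_cases h1 : z = x <;> by_cases h2 : z' = x' <;>
      simp [w, Matrix.vecMulVec_apply, h1, h2, eq_comm]
  have hc : choi T = (ampliation T _ (Matrix.vecMulVec w (star w))).submatrix
      (fun p : X × Y => (e p.1, p.2)) fun p : X × Y => (e p.1, p.2) := by
    ext p q
    simp only [choi, ampliation, Matrix.submatrix_apply, Matrix.of_apply, hw]
  rwa [hc]

theorem tensorOp_posSemidef {X : Type*} [Fintype X] {ℓ : ℕ} {P : Fin ℓ → Op X}
    (hP : ∀ i, (P i).PosSemidef) : (tensorOp P).PosSemidef := by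
  choose R hR using fun i => exists_eq_conjTranspose_mul_self (hP i)
  rw [funext hR, ← tensorOp_mul, ← tensorOp_conjTranspose]
  exact Matrix.posSemidef_conjTranspose_mul_self _

/-- Maps with positive Choi matrix preserve positivity. -/
theorem posSemidef_sum_mul_choi {X Y : Type*} [Fintype X] [Fintype Y] {P : Op X}
    (hP : P.PosSemidef) {D : Op (X × Y)} (hD : D.PosSemidef) :
    (Matrix.of fun y y' => ∑ x, ∑ x', P x x' * D (x, y) (x', y') : Op Y).PosSemidef := by
  classical
  obtain ⟨R, rfl⟩ := exists_eq_conjTranspose_mul_self hD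
  -- Kraus decomposition: each row of `R`, reshaped into an `X × Y` matrix, is the adjoint of a
  -- Kraus operator.
  have h : (Matrix.of fun y y' => ∑ x, ∑ x', P x x' * (Rᴴ * R) (x, y) (x', y') : Op Y) =
      ∑ r, (Matrix.of fun x y => R r (x, y))ᴴ * P * Matrix.of fun x y => R r (x, y) := by
    ext y y'
    simp only [Matrix.of_apply, Matrix.sum_apply, Matrix.mul_apply, Matrix.conjTranspose_apply,
      mul_sum, sum_mul]
    rw [sum_comm_cycle]
    refine sum_congr rfl fun r _ => ?_
    rw [sum_comm]
    exact sum_congr rfl fun x _ => sum_congr rfl fun x' _ => by ring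
  rw [h]
  exact Matrix.posSemidef_sum _ fun r _ => hP.conjTranspose_mul_mul_same _

/-- After regrouping the factors, the Choi matrix of `T^{⊗ℓ}` is the `ℓ`-th tensor power of that of
`T`, hence positive. -/
theorem tensorPowMap_posSemidef {X Y : Type*} [Fintype X] [DecidableEq X] [Fintype Y]
    {T : Op X →ₗ[ℂ] Op Y} (hT : IsCompletelyPositive T) {ℓ : ℕ} {P : Op (Pow X ℓ)}
    (hP : P.PosSemidef) : (tensorPowMap T ℓ P).PosSemidef := by
  have h := posSemidef_sum_mul_choi hP
    ((tensorOp_posSemidef fun _ : Fin ℓ => choi_posSemidef hT).submatrix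
      fun p : Pow X ℓ × Pow Y ℓ => fun i => (p.1 i, p.2 i))
  simp only [Matrix.submatrix_apply, tensorOp, choi, Matrix.of_apply] at h
  simpa only [tensorPowMap, LinearMap.coe_mk, AddHom.coe_mk] using h

theorem trace_mul_nonneg {X : Type*} [Fintype X] {P Q : Op X} (hP : P.PosSemidef)
    (hQ : Q.PosSemidef) : 0 ≤ (P * Q).trace := by
  obtain ⟨R, rfl⟩ := exists_eq_conjTranspose_mul_self hQ
  rw [← mul_assoc, Matrix.trace_mul_comm, ← mul_assoc]
  exact (hP.mul_mul_conjTranspose_same R).trace_nonneg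

end CompletePositivity

/-! ### The error functional and twirling -/

section ErrorFunctional

variable {A B J : Type*} [Fintype A] [Fintype B] [Fintype J]
  [DecidableEq A] [DecidableEq B] [DecidableEq J] {ℓ M : ℕ}

omit [DecidableEq B] in
theorem blockOutput_apply (N : Channel (A × J) B) (ρ : Op (Pow A ℓ)) (σ : Op (Pow J ℓ))
    (y y' : Pow B ℓ) : blockOutput N ρ σ y y' = ∑ u : Pow (A × J) ℓ, ∑ u' : Pow (A × J) ℓ,
      ρ (Prod.fst ∘ u) (Prod.fst ∘ u') * σ (Prod.snd ∘ u) (Prod.snd ∘ u') *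
        ∏ i, N.map (Matrix.single (u i) (u' i) 1) (y i) (y' i) :=
  rfl

omit [DecidableEq B] in
theorem blockOutput_posSemidef (N : Channel (A × J) B) {ρ : Op (Pow A ℓ)} {σ : Op (Pow J ℓ)}
    (hρ : ρ.PosSemidef) (hσ : σ.PosSemidef) : (blockOutput N ρ σ).PosSemidef :=
  tensorPowMap_posSemidef N.completelyPositive ((hρ.kronecker hσ).submatrix _)

/-- All positions carry the same channel, so permuting the positions of inputs and outputs together
only reorders the product of matrix entries. -/
theorem blockOutput_permOp_conj (N : Channel (A × J) B) (ρ : Op (Pow A ℓ)) (σ : Op (Pow J ℓ))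
    (π : Equiv.Perm (Fin ℓ)) :
    blockOutput N (permOp A π * ρ * (permOp A π)ᴴ) (permOp J π * σ * (permOp J π)ᴴ) =
      permOp B π * blockOutput N ρ σ * (permOp B π)ᴴ := by
  ext y y'
  rw [permOp_conj_apply, blockOutput_apply, blockOutput_apply]
  simp_rw [permOp_conj_apply]
  symm
  rw [← sum_comp_perm π]
  refine sum_congr rfl fun u _ => ?_
  rw [← sum_comp_perm π]
  refine sum_congr rfl fun u' _ => ?_
  congr 1
  exact (Equiv.prod_comp π fun i => N.map (Matrix.single (u i) (u' i) 1) (y i) (y' i))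

/-- The error probability of a code as a linear functional of the jammer's operator. -/
noncomputable def errorFunctional (N : Channel (A × J) B) (C : Code A B ℓ M) :
    Op (Pow J ℓ) →ₗ[ℂ] ℂ where
  toFun σ := ((1 / (M : ℝ) : ℝ) : ℂ) *
    ∑ m, (blockOutput N (C.enc m).op σ * (1 - C.dec m)).trace
  map_add' σ τ := by
    simp only [blockOutput, Matrix.kronecker_add, Matrix.reindex_apply, Matrix.submatrix_add,
      Pi.add_apply, map_add, add_mul, Matrix.trace_add, sum_add_distrib, mul_add]
  map_smul' c σ := by
    simp only [blockOutput, Matrix.kronecker_smul, Matrix.reindex_apply, Matrix.submatrix_smul,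
      Pi.smul_apply, map_smul, smul_mul_assoc, Matrix.trace_smul, ← smul_sum, mul_smul_comm,
      RingHom.id_apply]

theorem errorFunctional_apply (N : Channel (A × J) B) (C : Code A B ℓ M) (σ : Op (Pow J ℓ)) :
    errorFunctional N C σ = ((1 / (M : ℝ) : ℝ) : ℂ) *
      ∑ m, (blockOutput N (C.enc m).op σ * (1 - C.dec m)).trace :=
  rfl

theorem errorFunctional_re (N : Channel (A × J) B) (C : Code A B ℓ M) (σ : State (Pow J ℓ)) :
    (errorFunctional N C σ.op).re = errorProb N C σ := by
  rw [errorFunctional_apply, Complex.re_ofReal_mul, Complex.re_sum, errorProb]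

omit [DecidableEq A] in
theorem Code.one_sub_dec_posSemidef (C : Code A B ℓ M) (m : Fin M) :
    (1 - C.dec m).PosSemidef := by
  have h : 1 - C.dec m = ∑ m' ∈ univ.erase m, C.dec m' := by
    rw [← C.dec_sum, sub_eq_iff_eq_add, sum_erase_add _ _ (mem_univ m)]
  rw [h]
  exact Matrix.posSemidef_sum _ fun m' _ => C.dec_posSemidef m'

theorem errorFunctional_nonneg (N : Channel (A × J) B) (C : Code A B ℓ M) {P : Op (Pow J ℓ)}
    (hP : P.PosSemidef) : 0 ≤ errorFunctional N C P := by
  rw [errorFunctional_apply]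
  exact mul_nonneg (Complex.zero_le_real.mpr (by positivity)) <| sum_nonneg fun m _ =>
    trace_mul_nonneg (blockOutput_posSemidef N (C.enc m).posSemidef hP)
      (C.one_sub_dec_posSemidef m)

theorem permOp_inv_conj {X : Type*} [Fintype X] [DecidableEq X] (π : Equiv.Perm (Fin ℓ))
    (P : Op (Pow X ℓ)) :
    permOp X π * (permOp X π⁻¹ * P * (permOp X π⁻¹)ᴴ) * (permOp X π)ᴴ = P := by
  ext x y
  rw [permOp_conj_apply, permOp_conj_apply]
  congr 1 <;> ext i <;> simp

theorem trace_permOp_conj_mul {X : Type*} [Fintype X] [DecidableEq X] (π : Equiv.Perm (Fin ℓ))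
    (P D : Op (Pow X ℓ)) :
    (permOp X π * P * (permOp X π)ᴴ * (1 - permOp X π * D * (permOp X π)ᴴ)).trace =
      (P * (1 - D)).trace := by
  obtain ⟨h1, h2⟩ := permOp_unitary (X := X) π
  have h3 : 1 - permOp X π * D * (permOp X π)ᴴ = permOp X π * (1 - D) * (permOp X π)ᴴ := by
    rw [mul_sub, sub_mul, mul_one, h2]
  calc (permOp X π * P * (permOp X π)ᴴ * (1 - permOp X π * D * (permOp X π)ᴴ)).trace
      = (permOp X π * (P * ((permOp X π)ᴴ * permOp X π) * (1 - D)) * (permOp X π)ᴴ).trace := by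
        rw [h3]
        simp only [mul_assoc]
    _ = (P * (1 - D)).trace := by
        rw [h1, mul_one, Matrix.trace_mul_comm, ← mul_assoc, h1, one_mul]

/-- Permuting the code amounts to permuting the jammer's systems. -/
theorem errorProb_permute (N : Channel (A × J) B) (C : Code A B ℓ M) (π : Equiv.Perm (Fin ℓ))
    (ζ : State (Pow J ℓ)) :
    errorProb N (C.permute π) ζ = errorProb N C (ζ.permute π⁻¹) := by
  have h : ∀ m, (blockOutput N ((C.permute π).enc m).op ζ.op *
      (1 - (C.permute π).dec m)).trace =
      (blockOutput N (C.enc m).op (ζ.permute π⁻¹).op * (1 - C.dec m)).trace := fun m => by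
    rw [← trace_permOp_conj_mul π (blockOutput N (C.enc m).op _), ← blockOutput_permOp_conj]
    simp only [State.permute, permOp_inv_conj, Code.permute]
  simp only [errorProb, h]

/-- The average of a state over all permutations. -/
noncomputable def State.twirl {X : Type*} [Fintype X] [DecidableEq X] (ζ : State (Pow X ℓ)) :
    State (Pow X ℓ) where
  -- The inverse matches `errorProb_permute` term by term.
  op := ((ℓ ! : ℝ)⁻¹ : ℂ) • ∑ π : Equiv.Perm (Fin ℓ), (ζ.permute π⁻¹).op
  posSemidef := (Matrix.posSemidef_sum _ fun π _ => (ζ.permute π⁻¹).posSemidef).smul (by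
    rw [← Complex.ofReal_inv]
    exact Complex.zero_le_real.mpr (by positivity))
  trace_eq_one := by
    simp only [Matrix.trace_smul, Matrix.trace_sum, State.trace_eq_one, sum_const, card_univ,
      Fintype.card_perm, Fintype.card_fin, smul_eq_mul, nsmul_eq_mul, mul_one]
    push_cast
    exact inv_mul_cancel₀ (by exact_mod_cast ℓ.factorial_ne_zero)

theorem State.twirl_permInvariant {X : Type*} [Fintype X] [DecidableEq X]
    (ζ : State (Pow X ℓ)) (σ : Equiv.Perm (Fin ℓ)) :
    permOp X σ * ζ.twirl.op * (permOp X σ)ᴴ = ζ.twirl.op := by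
  ext x y
  rw [permOp_conj_apply]
  simp only [State.twirl, State.permute, Matrix.smul_apply, Matrix.sum_apply, permOp_conj_apply,
    Function.comp_assoc]
  congr 1
  refine Fintype.sum_equiv (Equiv.mulRight σ⁻¹) _ _ fun π => ?_
  rfl

theorem randomPermute_errorProb (N : Channel (A × J) B) (C : Code A B ℓ M)
    (ζ : State (Pow J ℓ)) :
    C.randomPermute.errorProb N ζ = (errorFunctional N C ζ.twirl.op).re := by
  simp only [RandomCode.errorProb, Code.randomPermute, errorProb_permute]
  simp only [State.twirl, map_smul, map_sum, smul_eq_mul, ← errorFunctional_re, PMF.uniformOfFintype_apply, Fintype.card_perm,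
    Fintype.card_fin, ← Complex.ofReal_inv, Complex.re_ofReal_mul, Complex.re_sum, mul_sum,
    ENNReal.toReal_inv, ENNReal.toReal_natCast]

/-- The final estimate multiplies the bound on the number of types by `ε`, whose sign is not
assumed. It follows from the existence of a jammer state, since `J ≠ 0`, and positivity of the error
functional. -/
theorem HasCompoundError.nonneg [Nonempty J] {N : Channel (A × J) B} {C : Code A B ℓ M} {ε : ℝ}
    (hC : HasCompoundError N C ε) : 0 ≤ ε := by
  obtain ⟨σ⟩ := (inferInstance : Nonempty (State J))
  refine le_trans ?_ (hC σ)
  rw [← errorProb_pow, ← errorFunctional_re]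
  exact (Complex.nonneg_iff.mp (errorFunctional_nonneg N C (σ.pow ℓ).posSemidef)).1

end ErrorFunctional

end QAVC

theorem proposition2 {A B J : Type*} [Fintype A] [Fintype B] [Fintype J]
    [DecidableEq A] [DecidableEq B] [DecidableEq J] [Nonempty J]
    (N : QAVC.Channel (A × J) B) (ℓ M : ℕ) (C : QAVC.Code A B ℓ M) (ε : ℝ)
    (hC : QAVC.HasCompoundError N C ε) (ζ : QAVC.State (QAVC.Pow J ℓ)) :
    C.randomPermute.errorProb N ζ ≤ ε * ((ℓ : ℝ) + 1) ^ (Fintype.card J ^ 2) := by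
  rw [QAVC.randomPermute_errorProb]
  refine (QAVC.functional_permInvariant_le (QAVC.errorFunctional N C)
    (fun P hP => QAVC.errorFunctional_nonneg N C hP) (fun σ => ?_) ζ.twirl
    ζ.twirl_permInvariant).trans (mul_le_mul_of_nonneg_left ?_ hC.nonneg)
  · rw [QAVC.errorFunctional_re, QAVC.errorProb_pow]
    exact hC σ
  -- The exponent `|J|²` is the dimension of `J ⊗ J`, where the purification lives.
  · have h := QAVC.card_piAntidiag_univ_le (K := J × J) ℓ
    rw [Fintype.card_prod, ← sq] at h
    exact_mod_cast h
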